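/- Let $(X,d)$ be a metric space with a Borel measure $\mu$ that is Ahlfors $\gamma$-regular for some $\gamma>0$: there are $c_1,c_2>0$ with $c_1r^\gamma\le\mu(B(x,r))\le c_2r^\gamma$ for all $x\in X$, $r>0$. Let $s>0$ and put $\sigma=s/\gamma$. For real-valued $u\in L^2(X,\mu)$ let $$\mathscr E^{d,\mu}_{\sigma}(u)=\iint_{X\times X}\frac{|u(x)-u(y)|^2}{\mu(B(x,d(x,y)))^{1+2\sigma}}\,d\mu(x)\,d\mu(y),\qquad H^{\sigma}_{d,\mu}=\{u\in L^2(X,\mu):\mathscr E^{d,\mu}_\sigma(u)<\infty\},$$ with the norm $\|u\|_{H^\sigma_{d,\mu}}=\|u\|_{L^2}+\sqrt{\mathscr E^{d,\mu}_\sigma(u)}$. A linear subspace $V\subseteq H^\sigma_{d,\mu}$ is called a space of coercivity if it is complete for $\|\cdot\|_{H^\sigma_{d,\mu}}$ and there is $c>0$ with $\mathscr E^{d,\mu}_\sigma(u)\ge c\|u\|_{L^2}^2$ for all $u\in V$. Let $$B^{d,\mu}_{s/\gamma}(u,v)=\iint_{X\times X}\frac{u(x)-u(y)}{d(x,y)^s}\,\frac{v(x)-v(y)}{d(x,y)^s}\,\frac{d\mu(x)\,d\mu(y)}{d(x,y)^{\gamma}}.$$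 A dyadic family is a family $\mathcal D=\bigcup_{j\in\mathbb Z}\mathcal D_j$ of Borel subsets (cubes) of $X$ such that: each $\mathcal D_j$ is a partition of $X$; for some $0<\nu<1$ and constants $0<c\le C$, every $Q\in\mathcal D_j$ has $c\nu^j\le\operatorname{diam}Q\le C\nu^j$ and $c\le \sup\{r_1/r_2: B(x_1,r_1)\subseteq Q\subseteq B(x_2,r_2)\}\le C$; each $Q\in\mathcal D_{j+1}$ is contained in exactly one cube of $\mathcal D_j$; for each $Q\in\mathcal D_j$ the set $\vartheta(Q)$ of the cubes of $\mathcal D_{j+1}$ contained in $Q$ has at least $1$ and at most $M$ elements, $M$ independent of $Q$ and $j$; two cubes of $\mathcal D$ are disjoint or one contains the other; and for each $Q\in\mathcal D$ the union of the cubes of $\mathcal D$ containing $Q$ is $X$. A Haar system $\mathscr H=\bigcup_{Q}\mathscr H(Q)$ of $\mathcal D$ is a choice, for each cube $Q$, of a set $\mathscr H(Q)\subset L^2(X,\mu)$ that together with $\mu(Q)^{-1/2}\mathcal X_Q$ (not in $\mathscr H(Q)$) forms an orthonormal basis of the space of functions vanishing outside $Q$ and constant on each $Q'\in\vartheta(Q)$.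 Let $P_j$ be the orthogonal projection of $L^2(X,\mu)$ onto the space of $L^2$ functions constant on each $Q\in\mathcal D_j$, and, for $\lambda>0$, let $\Pi_\lambda$ be the orthogonal projection of $L^2(X,\mu)$ onto the closed linear span of the $h\in\mathscr H(Q)$, $Q\in\mathcal D$, $\mu(Q)>\lambda$. Theorem. (1) For every dyadic family $\mathcal D$ on $X$, the spaces $H^{s/\gamma}_{d,\mu}\cap\operatorname{Ker}\Pi_\lambda$ (for every Haar system of $\mathcal D$ and every $\lambda>0$) and $H^{s/\gamma}_{d,\mu}\cap\operatorname{Ker}P_j$ (for every $j\in\mathbb Z$) are spaces of coercivity. (2) On every space of coercivity $V=H^{s/\gamma,0}_{d,\mu}$, in particular on those in (1), the bilinear form $B=B^{d,\mu}_{s/\gamma}$ is bounded and coercive: there are constants $C$ and $c>0$ such that, for all $u,v\in V$, the integral defining $B(u,v)$ converges absolutely, $|B(u,v)|\le C\|u\|_{H^{s/\gamma}_{d,\mu}}\|v\|_{H^{s/\gamma}_{d,\mu}}$ and $B(u,u)\ge c\|u\|_{H^{s/\gamma}_{d,\mu}}^2$. Moreover, for every linear functional $f$ on $V$ that is bounded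 for $\|\cdot\|_{H^{s/\gamma}_{d,\mu}}$ there is a unique $u\in V$ with $B(u,v)=\langle f,v\rangle$ for all $v\in V$. -/

import Mathlib

open MeasureTheory Set Filter Topology
open scoped ENNReal

noncomputable section

namespace HomType

/-- Ahlfors `γ`-regularity of a Borel measure `μ` on a metric space, `γ > 0`:
`c₁ r ^ γ ≤ μ (B(x, r)) ≤ c₂ r ^ γ` for every point `x` and every `r > 0`. -/
structure AhlforsRegular {X : Type*} [MetricSpace X] [MeasurableSpace X]
    (γ : ℝ) (μ : Measure X) : Prop where
  pos : 0 < γ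
  regular : ∃ c₁ c₂ : ℝ, 0 < c₁ ∧ 0 < c₂ ∧ ∀ (x : X) (r : ℝ), 0 < r →
    ENNReal.ofReal (c₁ * r ^ γ) ≤ μ (Metric.ball x r) ∧
      μ (Metric.ball x r) ≤ ENNReal.ofReal (c₂ * r ^ γ)

section Dyadic

variable {X : Type*} [MetricSpace X]

/-- The eccentricity of a set: the supremum of `r(B₁) / r(B₂)` over the balls `B₁ ⊆ Q ⊆ B₂`. -/
def eccentricity (Q : Set X) : ℝ≥0∞ :=
  ⨆ (x₁ : X) (r₁ : ℝ) (x₂ : X) (r₂ : ℝ) (_ : 0 < r₁) (_ : 0 < r₂)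
    (_ : Metric.ball x₁ r₁ ⊆ Q) (_ : Q ⊆ Metric.ball x₂ r₂), ENNReal.ofReal (r₁ / r₂)

/-- The offspring of a cube `Q` of level `j`. -/
def offspring (D : ℤ → Set (Set X)) (j : ℤ) (Q : Set X) : Set (Set X) :=
  {Q' | Q' ∈ D (j + 1) ∧ Q' ⊆ Q}

/-- Christ's dyadic families; `D j` is the family of the cubes of level `j`, and the whole family
is the union of the `D j`. -/
structure IsDyadicFamily [MeasurableSpace X] (D : ℤ → Set (Set X)) : Prop where
  size : ∃ ν : ℝ, 0 < ν ∧ ν < 1 ∧ ∃ c C : ℝ, 0 < c ∧ 0 < C ∧ ∀ j : ℤ, ∀ Q ∈ D j,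
    (ENNReal.ofReal (c * ν ^ j) ≤ Metric.ediam Q ∧ Metric.ediam Q ≤ ENNReal.ofReal (C * ν ^ j)) ∧
    (ENNReal.ofReal c ≤ eccentricity Q ∧ eccentricity Q ≤ ENNReal.ofReal C)
  measurableSet : ∀ j : ℤ, ∀ Q ∈ D j, MeasurableSet Q
  partition : ∀ j : ℤ, Setoid.IsPartition (D j)
  parent : ∀ j : ℤ, ∀ Q ∈ D (j + 1), ∃! Q', Q' ∈ D j ∧ Q ⊆ Q'
  offspring_card : ∃ M : ℕ, ∀ j : ℤ, ∀ Q ∈ D j,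
    1 ≤ (offspring D j Q).encard ∧ (offspring D j Q).encard ≤ M
  nested : ∀ Q ∈ ⋃ j, D j, ∀ R ∈ ⋃ j, D j, R ∩ Q = ∅ ∨ R ⊆ Q ∨ Q ⊆ R
  quadrant : ∀ Q ∈ ⋃ j, D j, ⋃₀ {R | R ∈ ⋃ j, D j ∧ Q ⊆ R} = univ

end Dyadic

section Haar

variable {X : Type*} [MeasurableSpace X]

/-- The functions of `L²` that are (almost everywhere) constant on each set of the family `𝒬`
and vanish (almost everywhere) outside `S`. -/
def stepSpace (μ : Measure X) (𝒬 : Set (Set X)) (S : Set X) : Submodule ℝ (Lp ℝ 2 μ) where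
  carrier := {f | (∀ Q ∈ 𝒬, ∃ a : ℝ, ∀ᵐ x ∂μ, x ∈ Q → f x = a) ∧ ∀ᵐ x ∂μ, x ∉ S → f x = 0}
  zero_mem' := by
    refine ⟨fun Q _ => ⟨0, ?_⟩, ?_⟩
    · filter_upwards [Lp.coeFn_zero ℝ 2 μ] with x hx _ using hx
    · filter_upwards [Lp.coeFn_zero ℝ 2 μ] with x hx _ using hx
  add_mem' := by
    rintro f g ⟨hf, hf'⟩ ⟨hg, hg'⟩
    refine ⟨fun Q hQ => ?_, ?_⟩
    · obtain ⟨a, ha⟩ := hf Q hQ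
      obtain ⟨b, hb⟩ := hg Q hQ
      refine ⟨a + b, ?_⟩
      filter_upwards [Lp.coeFn_add f g, ha, hb] with x hx h1 h2 hxQ
      rw [hx, Pi.add_apply, h1 hxQ, h2 hxQ]
    · filter_upwards [Lp.coeFn_add f g, hf', hg'] with x hx h1 h2 hxS
      rw [hx, Pi.add_apply, h1 hxS, h2 hxS, add_zero]
  smul_mem' := by
    rintro c f ⟨hf, hf'⟩
    refine ⟨fun Q hQ => ?_, ?_⟩
    · obtain ⟨a, ha⟩ := hf Q hQ
      refine ⟨c * a, ?_⟩
      filter_upwards [Lp.coeFn_smul c f, ha] with x hx h1 hxQ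
      rw [hx, Pi.smul_apply, h1 hxQ, smul_eq_mul]
    · filter_upwards [Lp.coeFn_smul c f, hf'] with x hx h1 hxS
      rw [hx, Pi.smul_apply, h1 hxS, smul_zero]

/-- The space `V_j` of the functions of `L²` that are constant on each cube of level `j`. -/
def levelSpace (μ : Measure X) (D : ℤ → Set (Set X)) (j : ℤ) : Submodule ℝ (Lp ℝ 2 μ) :=
  stepSpace μ (D j) univ

/-- The orthogonal projector `P_j` of `L²` onto `V_j`. (The space `V_j` is closed; the closure is
written only so that the projector is available without a proof of this.) -/
def levelProj (μ : Measure X) (D : ℤ → Set (Set X)) (j : ℤ) : Lp ℝ 2 μ →L[ℝ] Lp ℝ 2 μ :=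
  (levelSpace μ D j).topologicalClosure.starProjection

open Classical in
/-- The normalized indicator `μ(Q)^{-1/2} 1_Q`, as an element of `L²` (set to be `0` if this is not
square integrable, which never occurs for the cubes of a dyadic family). -/
def normIndicator (μ : Measure X) (Q : Set X) : Lp ℝ 2 μ :=
  if h : MemLp (Q.indicator fun _ => (1 / √(μ.real Q) : ℝ)) 2 μ then h.toLp else 0

/-- A Haar system associated with the dyadic family `D`: `𝓗 j Q` is the set of the Haar functions
based on the cube `Q` of level `j`. Together with the normalized indicator of `Q` they form an
orthonormal basis of the space of the functions that vanish outside `Q` and are constant on each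
offspring of `Q`. (If `Q` has only one offspring then this forces `𝓗 j Q = ∅`.) -/
structure IsHaarSystem (μ : Measure X) (D : ℤ → Set (Set X))
    (𝓗 : ℤ → Set X → Set (Lp ℝ 2 μ)) : Prop where
  notMem : ∀ j : ℤ, ∀ Q ∈ D j, normIndicator μ Q ∉ 𝓗 j Q
  orthonormal : ∀ j : ℤ, ∀ Q ∈ D j,
    Orthonormal ℝ (Subtype.val : (insert (normIndicator μ Q) (𝓗 j Q) : Set _) → Lp ℝ 2 μ)
  span_eq : ∀ j : ℤ, ∀ Q ∈ D j,
    Submodule.span ℝ (insert (normIndicator μ Q) (𝓗 j Q)) = stepSpace μ (offspring D j Q) Q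

/-- The closed linear span `M_t` in `L²` of the Haar functions based on cubes with `μ(Q) > t`. -/
def haarSpace (μ : Measure X) (D : ℤ → Set (Set X)) (𝓗 : ℤ → Set X → Set (Lp ℝ 2 μ)) (t : ℝ) :
    Submodule ℝ (Lp ℝ 2 μ) :=
  (Submodule.span ℝ
    {h | ∃ j : ℤ, ∃ Q ∈ D j, ENNReal.ofReal t < μ Q ∧ h ∈ 𝓗 j Q}).topologicalClosure

/-- The orthogonal projector `Π_t` of `L²` onto `M_t`. -/
def haarProj (μ : Measure X) (D : ℤ → Set (Set X)) (𝓗 : ℤ → Set X → Set (Lp ℝ 2 μ)) (t : ℝ) :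
    Lp ℝ 2 μ →L[ℝ] Lp ℝ 2 μ :=
  haveI : CompleteSpace (haarSpace μ D 𝓗 t) := Submodule.topologicalClosure.completeSpace _
  (haarSpace μ D 𝓗 t).starProjection

end Haar

section Energy

variable {X : Type*} [MetricSpace X] [MeasurableSpace X]

/-- The energy `∬ |u(x) - u(y)|² / μ(B(x, d(x, y))) ^ (1 + 2σ) dμ(x) dμ(y)`. -/
def energy (μ : Measure X) (σ : ℝ) (u : X → ℝ) : ℝ≥0∞ :=
  ∫⁻ p : X × X, ENNReal.ofReal (|u p.1 - u p.2| ^ 2) /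
    μ (Metric.ball p.1 (dist p.1 p.2)) ^ (1 + 2 * σ) ∂(μ.prod μ)

/-- The norm `‖u‖_{L²} + (energy of u)^{1/2}`. -/
def sobolevNorm (μ : Measure X) (σ : ℝ) (u : Lp ℝ 2 μ) : ℝ :=
  ‖u‖ + √(energy μ σ u).toReal

/-- The integrand of the Dirichlet form. -/
def dirichletIntegrand (s γ : ℝ) (u v : X → ℝ) (p : X × X) : ℝ :=
  (u p.1 - u p.2) / dist p.1 p.2 ^ s * ((v p.1 - v p.2) / dist p.1 p.2 ^ s) / dist p.1 p.2 ^ γ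

/-- The Dirichlet form
`∬ (u(x) - u(y)) / d(x, y)^s * (v(x) - v(y)) / d(x, y)^s * d(x, y)^{-γ} dμ(x) dμ(y)`. -/
def dirichletForm (μ : Measure X) (s γ : ℝ) (u v : X → ℝ) : ℝ :=
  ∫ p : X × X, dirichletIntegrand s γ u v p ∂(μ.prod μ)

theorem AhlforsRegular.sigmaFinite [BorelSpace X] {γ : ℝ} {μ : Measure X}
    (h : AhlforsRegular γ μ) : SigmaFinite μ := by
  obtain ⟨c₁, c₂, -, -, H⟩ := h.regular
  rcases isEmpty_or_nonempty X with hX | ⟨⟨x₀⟩⟩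
  · have : μ = 0 := Measure.eq_zero_of_isEmpty μ
    rw [this]; infer_instance
  · refine ⟨⟨⟨fun n : ℕ => Metric.ball x₀ (n + 1), fun _ => trivial, fun n => ?_, ?_⟩⟩⟩
    · exact (H x₀ (n + 1) (by positivity)).2.trans_lt ENNReal.ofReal_lt_top
    · refine eq_univ_of_forall fun x => mem_iUnion.2 ?_
      obtain ⟨n, hn⟩ := exists_nat_gt (dist x x₀)
      exact ⟨n, Metric.mem_ball.2 (by linarith)⟩

theorem energy_congr {μ : Measure X} [SFinite μ] (σ : ℝ) {u v : X → ℝ}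
    (h : u =ᵐ[μ] v) : energy μ σ u = energy μ σ v := by
  have h1 := (Measure.quasiMeasurePreserving_fst (μ := μ) (ν := μ)).ae_eq_comp h
  have h2 := (Measure.quasiMeasurePreserving_snd (μ := μ) (ν := μ)).ae_eq_comp h
  refine lintegral_congr_ae ?_
  filter_upwards [h1, h2] with p hp1 hp2
  simp only [Function.comp_apply] at hp1 hp2
  rw [hp1, hp2]

theorem energy_smul (μ : Measure X) (σ : ℝ) (c : ℝ) (u : X → ℝ) :
    energy μ σ (c • u) = ENNReal.ofReal (c ^ 2) * energy μ σ u := by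
  unfold energy
  rw [← lintegral_const_mul' _ _ ENNReal.ofReal_ne_top]
  refine lintegral_congr fun p => ?_
  rw [← mul_div_assoc, ← ENNReal.ofReal_mul (sq_nonneg c)]
  congr 2
  simp only [Pi.smul_apply, smul_eq_mul, sq_abs]
  ring

theorem energy_add_le (μ : Measure X) (σ : ℝ) {u v : X → ℝ} (hu : Measurable u)
    (hv : Measurable v) :
    energy μ σ (u + v) ≤ ENNReal.ofReal 4 * energy μ σ u + ENNReal.ofReal 4 * energy μ σ v := by
  unfold energy
  rw [← lintegral_const_mul' _ _ ENNReal.ofReal_ne_top,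
    ← lintegral_const_mul' _ _ ENNReal.ofReal_ne_top]
  have hA : MeasurableSet {p : X × X | |v p.1 - v p.2| ≤ |u p.1 - u p.2|} := by
    refine measurableSet_le ?_ ?_
    · exact ((hv.comp measurable_fst).sub (hv.comp measurable_snd)).abs
    · exact ((hu.comp measurable_fst).sub (hu.comp measurable_snd)).abs
  rw [← lintegral_add_compl _ hA]
  refine add_le_add ?_ ?_
  · refine (setLIntegral_mono' hA fun p hp => ?_).trans (setLIntegral_le_lintegral _ _)
    rw [← mul_div_assoc, ← ENNReal.ofReal_mul (by norm_num)]
    refine ENNReal.div_le_div_right (ENNReal.ofReal_le_ofReal ?_) _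
    have hp' : |v p.1 - v p.2| ≤ |u p.1 - u p.2| := hp
    have : |(u + v) p.1 - (u + v) p.2| ≤ 2 * |u p.1 - u p.2| := by
      calc |(u + v) p.1 - (u + v) p.2| = |(u p.1 - u p.2) + (v p.1 - v p.2)| := by
            simp only [Pi.add_apply]; congr 1; ring
        _ ≤ |u p.1 - u p.2| + |v p.1 - v p.2| := abs_add_le _ _
        _ ≤ _ := by linarith
    nlinarith [abs_nonneg ((u + v) p.1 - (u + v) p.2)]
  · refine (setLIntegral_mono' hA.compl fun p hp => ?_).trans (setLIntegral_le_lintegral _ _)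
    rw [← mul_div_assoc, ← ENNReal.ofReal_mul (by norm_num)]
    refine ENNReal.div_le_div_right (ENNReal.ofReal_le_ofReal ?_) _
    have hp' : |u p.1 - u p.2| < |v p.1 - v p.2| := not_le.1 hp
    have : |(u + v) p.1 - (u + v) p.2| ≤ 2 * |v p.1 - v p.2| := by
      calc |(u + v) p.1 - (u + v) p.2| = |(u p.1 - u p.2) + (v p.1 - v p.2)| := by
            simp only [Pi.add_apply]; congr 1; ring
        _ ≤ |u p.1 - u p.2| + |v p.1 - v p.2| := abs_add_le _ _
        _ ≤ _ := by linarith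
    nlinarith [abs_nonneg ((u + v) p.1 - (u + v) p.2)]

/-- The space of the functions of `L²` with finite energy. The regularity hypothesis serves only to
see that this is a vector space. -/
def sobolevSpace [BorelSpace X] {γ : ℝ} {μ : Measure X} (h : AhlforsRegular γ μ) (σ : ℝ) :
    Submodule ℝ (Lp ℝ 2 μ) where
  carrier := {u | energy μ σ u < ∞}
  zero_mem' := by
    have := h.sigmaFinite
    change energy μ σ _ < ∞
    rw [energy_congr σ (Lp.coeFn_zero ℝ 2 μ)]
    simp [energy]
  add_mem' := by
    have := h.sigmaFinite
    intro u v hu hv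
    change energy μ σ _ < ∞
    rw [energy_congr σ (Lp.coeFn_add u v)]
    refine (energy_add_le μ σ (Lp.stronglyMeasurable u).measurable
      (Lp.stronglyMeasurable v).measurable).trans_lt ?_
    exact ENNReal.add_lt_top.2 ⟨ENNReal.mul_lt_top ENNReal.ofReal_lt_top hu,
      ENNReal.mul_lt_top ENNReal.ofReal_lt_top hv⟩
  smul_mem' := by
    have := h.sigmaFinite
    intro c u hu
    change energy μ σ _ < ∞
    rw [energy_congr σ (Lp.coeFn_smul c u), energy_smul]
    exact ENNReal.mul_lt_top ENNReal.ofReal_lt_top hu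

/-- A space of coercivity for the energy: a subspace of the space of the functions of `L²` with
finite energy that is complete for the norm `sobolevNorm` (a Hilbert subspace) and on which the
energy dominates a positive multiple of the square of the `L²` norm. -/
structure IsCoercivitySpace [BorelSpace X] {γ : ℝ} {μ : Measure X} (h : AhlforsRegular γ μ)
    (σ : ℝ) (V : Submodule ℝ (Lp ℝ 2 μ)) : Prop where
  le_sobolevSpace : V ≤ sobolevSpace h σ
  complete : ∀ w : ℕ → Lp ℝ 2 μ, (∀ n, w n ∈ V) →
    (∀ ε > 0, ∃ N, ∀ m ≥ N, ∀ n ≥ N, sobolevNorm μ σ (w m - w n) < ε) →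
    ∃ u ∈ V, Tendsto (fun n => sobolevNorm μ σ (w n - u)) atTop (𝓝 0)
  coercive : ∃ c : ℝ, 0 < c ∧ ∀ u ∈ V, ENNReal.ofReal (c * ‖u‖ ^ 2) ≤ energy μ σ u

end Energy

end HomType

end

noncomputable section

namespace HomType

/-! ### Ahlfors regular measures: finiteness and separability -/

section Regular

variable {X : Type*} [MetricSpace X] [MeasurableSpace X] {γ : ℝ} {μ : Measure X}

/-! Write `T u (x, y) = (u(x) - u(y)) / d(x, y) ^ (s + γ / 2)` (`diffQuotLin`). Then `B(u, v) = ⟪T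
u, T v⟫` in `L²(μ × μ)`. Since `γ (1 + 2 s / γ) = γ + 2 s`, regularity makes the energy comparable
to `‖T u‖²` (`AhlforsRegular.energy_comparable`). The operator `T` is closed, so its domain
intersected with the kernel of any bounded operator is complete for the Sobolev norm.

Coercivity in (1) is a Poincaré inequality. If `u` has integral zero on a cube `Q`, then `μ(Q) ∫_Q
u²` is at most the integral of `(u(x) - u(y))²` over `Q × Q`, hence at most a power of the diameter
of `Q` times the integral of `(T u)²` there. Cubes of one level have measures bounded below and
diameters bounded above, so summing over them gives coercivity.

It remains to find a level on whose cubes `u` has mean zero. If `P_j u = 0`, test against the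
indicators of the cubes of level `j`. If `Π_λ u = 0`, orthogonality to the Haar functions gives `u`
equal means on a cube with `μ(Q) > λ` and on all its ancestors. Their measures tend to infinity, so
the means tend to zero by Cauchy–Schwarz and therefore vanish.

For (2), on a space of coercivity `‖T u‖` is equivalent to the Sobolev norm. Boundedness is
Cauchy–Schwarz, and the representation of functionals is the Riesz theorem on the range of `T`. -/

theorem AhlforsRegular.measure_ball_pos (h : AhlforsRegular γ μ) (x : X) {r : ℝ} (hr : 0 < r) :
    0 < μ (Metric.ball x r) := by
  obtain ⟨c₁, c₂, h₁, -, H⟩ := h.regular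
  exact (ENNReal.ofReal_pos.2 (by positivity)).trans_le (H x r hr).1

theorem AhlforsRegular.measure_lt_top (h : AhlforsRegular γ μ) {S : Set X}
    (hS : Bornology.IsBounded S) : μ S < ∞ := by
  obtain ⟨c₁, c₂, -, -, H⟩ := h.regular
  rcases S.eq_empty_or_nonempty with rfl | ⟨x, -⟩
  · simp
  · obtain ⟨r, hr, hSr⟩ := hS.subset_ball_lt 0 x
    exact (measure_mono hSr).trans_lt ((H x r hr).2.trans_lt ENNReal.ofReal_lt_top)

/-- Disjoint balls have positive measure, so σ-finiteness allows only countably many; the centres of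
a Vitali family of balls of radius `ε / 5` form a countable `ε`-net. Separability makes the distance
measurable for the product σ-algebra. -/
theorem AhlforsRegular.secondCountableTopology [BorelSpace X] (h : AhlforsRegular γ μ) :
    SecondCountableTopology X := by
  have := h.sigmaFinite
  refine Metric.secondCountable_of_almost_dense_set fun ε hε => ?_
  obtain ⟨S, -, hdisj, hcov⟩ := Vitali.exists_disjoint_subfamily_covering_enlargement_closedBall
    (univ : Set X) id (fun _ => ε / 5) (ε / 5) (fun _ _ => le_rfl)
    5 (by norm_num)
  refine ⟨S, ?_, fun x => ?_⟩
  · refine Set.countable_coe_iff.1 ?_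
    have := Measure.countable_meas_pos_of_disjoint_iUnion (μ := μ)
      (As := fun a : S => Metric.closedBall (a : X) (ε / 5))
      (fun a => measurableSet_closedBall)
      (fun a b hab => hdisj a.2 b.2 (fun e => hab (Subtype.ext e)))
    refine Set.countable_univ_iff.1 (this.mono fun a _ => ?_)
    exact (h.measure_ball_pos _ (by positivity)).trans_le (measure_mono Metric.ball_subset_closedBall)
  · obtain ⟨b, hb, hsub⟩ := hcov x (mem_univ x)
    refine ⟨b, hb, ?_⟩
    have := hsub (Metric.mem_closedBall_self (by positivity))
    rw [Metric.mem_closedBall] at this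
    simpa using this.trans_eq (by ring)

end Regular

/-! ### The difference quotient operator and the energy -/

section Quotient

variable {X : Type*} [MetricSpace X]

/-- The fractional difference quotient `(u(x) - u(y)) / d(x, y) ^ (s + γ / 2)`. -/
def diffQuot (s γ : ℝ) (u : X → ℝ) (p : X × X) : ℝ :=
  (u p.1 - u p.2) / (dist p.1 p.2 ^ s * dist p.1 p.2 ^ (γ / 2))

/-- Giving half of `d ^ (-γ)` to each factor turns the form into an `L²(μ × μ)` inner product. -/
theorem dirichletIntegrand_eq_mul {γ : ℝ} (hγ : 0 < γ) (s : ℝ) (u v : X → ℝ) (p : X × X) :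
    dirichletIntegrand s γ u v p = diffQuot s γ u p * diffQuot s γ v p := by
  have : dist p.1 p.2 ^ γ = dist p.1 p.2 ^ (γ / 2) * dist p.1 p.2 ^ (γ / 2) := by
    rw [← Real.rpow_add_of_nonneg dist_nonneg (by positivity) (by positivity), add_halves]
  rw [dirichletIntegrand, this, diffQuot, diffQuot, div_mul_div_comm, div_div, div_mul_div_comm]
  congr 1
  ring

theorem diffQuot_sq {γ : ℝ} (hγ : 0 < γ) {s : ℝ} (hs : 0 < s) (u : X → ℝ) (p : X × X) :
    diffQuot s γ u p ^ 2 = |u p.1 - u p.2| ^ 2 / dist p.1 p.2 ^ (γ + 2 * s) := by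
  rw [diffQuot, div_pow, sq_abs, mul_pow, ← Real.rpow_mul_natCast dist_nonneg,
    ← Real.rpow_mul_natCast dist_nonneg, ← Real.rpow_add_of_nonneg dist_nonneg
    (by positivity) (by positivity)]
  congr 2
  push_cast
  ring

theorem measurable_diffQuot [MeasurableSpace X] [BorelSpace X] [SecondCountableTopology X]
    (s γ : ℝ) {u : X → ℝ} (hu : Measurable u) : Measurable (diffQuot s γ u) := by
  unfold diffQuot
  exact ((hu.comp measurable_fst).sub (hu.comp measurable_snd)).div ((measurable_dist.pow_const _).mul (measurable_dist.pow_const _))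

/-- The energy with the measure of the ball replaced by the power of the distance. -/
def distEnergy [MeasurableSpace X] (μ : Measure X) (s γ : ℝ) (u : X → ℝ) : ℝ≥0∞ :=
  ∫⁻ p : X × X, ENNReal.ofReal (diffQuot s γ u p ^ 2) ∂(μ.prod μ)

/-- Raise the bounds on the measure of a ball to the power `q = 1 + 2 s / γ`: the radius then
appears to the power `γ q = γ + 2 s`, and the constants are `c₁ ^ q` and `c₂ ^ q`. -/
theorem AhlforsRegular.energy_comparable [MeasurableSpace X] {γ : ℝ} {μ : Measure X}
    (h : AhlforsRegular γ μ) {s : ℝ} (hs : 0 < s) :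
    ∃ A : ℝ, 0 < A ∧ ∀ u : X → ℝ,
      energy μ (s / γ) u ≤ ENNReal.ofReal A * distEnergy μ s γ u ∧
        distEnergy μ s γ u ≤ ENNReal.ofReal A * energy μ (s / γ) u := by
  have hγ := h.pos
  obtain ⟨c₁, c₂, h₁, h₂, H⟩ := h.regular
  set q : ℝ := 1 + 2 * (s / γ) with hq
  have hq0 : 0 < q := by positivity
  have hγq : γ * q = γ + 2 * s := by rw [hq]; field_simp
  have key : ∀ c d : ℝ, 0 < c → 0 < d →
      ENNReal.ofReal (c * d ^ γ) ^ q = ENNReal.ofReal (c ^ q * d ^ (γ + 2 * s)) := by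
    intro c d hc hd
    rw [ENNReal.ofReal_rpow_of_nonneg (by positivity) hq0.le, Real.mul_rpow hc.le (by positivity),
      ← Real.rpow_mul hd.le, hγq]
  refine ⟨max (c₁ ^ q)⁻¹ (c₂ ^ q), lt_max_of_lt_right (by positivity), fun u => ⟨?_, ?_⟩⟩
  · rw [distEnergy, energy, ← lintegral_const_mul' _ _ ENNReal.ofReal_ne_top]
    refine lintegral_mono fun p => ?_
    dsimp only
    rw [diffQuot_sq hγ hs, ← ENNReal.ofReal_mul (by positivity)]
    rcases eq_or_ne p.1 p.2 with e | e
    -- On the diagonal both integrands are `0`, since the numerators vanish and `0 / 0 = 0`.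
    · simp [e]
    have hd := dist_pos.2 e
    calc _ ≤ ENNReal.ofReal (|u p.1 - u p.2| ^ 2) /
          ENNReal.ofReal (c₁ ^ q * dist p.1 p.2 ^ (γ + 2 * s)) := by
            rw [← key _ _ h₁ hd]
            exact ENNReal.div_le_div_left (ENNReal.rpow_le_rpow (H _ _ hd).1 hq0.le) _
      _ = ENNReal.ofReal ((c₁ ^ q)⁻¹ * (|u p.1 - u p.2| ^ 2 / dist p.1 p.2 ^ (γ + 2 * s))) := by
            rw [← ENNReal.ofReal_div_of_pos (by positivity)]
            congr 1
            field_simp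
      _ ≤ _ := ENNReal.ofReal_le_ofReal
            (mul_le_mul_of_nonneg_right (le_max_left _ _) (by positivity))
  · rw [distEnergy, energy, ← lintegral_const_mul' _ _ ENNReal.ofReal_ne_top]
    refine lintegral_mono fun p => ?_
    dsimp only
    rw [diffQuot_sq hγ hs]
    rcases eq_or_ne p.1 p.2 with e | e
    · simp [e]
    have hd := dist_pos.2 e
    calc _ = ENNReal.ofReal (c₂ ^ q) * (ENNReal.ofReal (|u p.1 - u p.2| ^ 2) /
          ENNReal.ofReal (c₂ ^ q * dist p.1 p.2 ^ (γ + 2 * s))) := by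
            rw [← ENNReal.ofReal_div_of_pos (by positivity), ← ENNReal.ofReal_mul (by positivity)]
            congr 1
            field_simp
      _ ≤ ENNReal.ofReal (c₂ ^ q) * (ENNReal.ofReal (|u p.1 - u p.2| ^ 2) /
          μ (Metric.ball p.1 (dist p.1 p.2)) ^ q) := by
            rw [← key _ _ h₂ hd]
            gcongr
            exact (H _ _ hd).2
      _ ≤ _ := by
            gcongr
            exact le_max_right _ _

theorem memLp_diffQuot [MeasurableSpace X] [BorelSpace X] [SecondCountableTopology X]
    {μ : Measure X} {s γ : ℝ} {u : X → ℝ} (hu : Measurable u) :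
    MemLp (diffQuot s γ u) 2 (μ.prod μ) ↔ distEnergy μ s γ u < ∞ := by
  have hm := measurable_diffQuot s γ hu
  rw [memLp_two_iff_integrable_sq hm.aestronglyMeasurable, distEnergy, Integrable,
    hasFiniteIntegral_iff_ofReal (ae_of_all _ fun p => sq_nonneg _)]
  exact and_iff_right (hm.pow_const 2).aestronglyMeasurable

theorem diffQuot_congr [MeasurableSpace X] {μ : Measure X} [SFinite μ] (s γ : ℝ) {u v : X → ℝ}
    (h : u =ᵐ[μ] v) : diffQuot s γ u =ᵐ[μ.prod μ] diffQuot s γ v := by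
  filter_upwards [(Measure.quasiMeasurePreserving_fst (μ := μ) (ν := μ)).ae_eq_comp h,
    (Measure.quasiMeasurePreserving_snd (μ := μ) (ν := μ)).ae_eq_comp h] with p h1 h2
  simp only [Function.comp_apply] at h1 h2
  rw [diffQuot, diffQuot, h1, h2]

theorem AhlforsRegular.memLp_diffQuot_iff [MeasurableSpace X] [BorelSpace X] {γ : ℝ}
    {μ : Measure X} (h : AhlforsRegular γ μ) {s : ℝ} (hs : 0 < s) (u : Lp ℝ 2 μ) :
    MemLp (diffQuot s γ u) 2 (μ.prod μ) ↔ u ∈ sobolevSpace h (s / γ) := by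
  have := h.secondCountableTopology
  rw [memLp_diffQuot (Lp.stronglyMeasurable u).measurable]
  change _ ↔ energy μ (s / γ) u < ∞
  obtain ⟨A, hA, H⟩ := h.energy_comparable hs
  exact ⟨fun hu => (H u).1.trans_lt (ENNReal.mul_lt_top ENNReal.ofReal_lt_top hu),
    fun hu => (H u).2.trans_lt (ENNReal.mul_lt_top ENNReal.ofReal_lt_top hu)⟩

/-- The difference quotient as a linear map into `L²(μ × μ)`. -/
def diffQuotLin [MeasurableSpace X] [BorelSpace X] {γ : ℝ} {μ : Measure X}
    (h : AhlforsRegular γ μ) {s : ℝ} (hs : 0 < s) :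
    sobolevSpace h (s / γ) →ₗ[ℝ] Lp ℝ 2 (μ.prod μ) where
  toFun u := ((h.memLp_diffQuot_iff hs u).2 u.2).toLp
  map_add' u v := by
    have := h.sigmaFinite
    rw [← MemLp.toLp_add]
    refine MemLp.toLp_congr _ _ ((diffQuot_congr s γ (Lp.coeFn_add (u : Lp ℝ 2 μ) v)).trans
      (Eventually.of_forall fun p => ?_))
    simp only [diffQuot, Pi.add_apply]
    ring
  map_smul' c u := by
    have := h.sigmaFinite
    rw [RingHom.id_apply, ← MemLp.toLp_const_smul]
    refine MemLp.toLp_congr _ _ ((diffQuot_congr s γ (Lp.coeFn_smul c (u : Lp ℝ 2 μ))).trans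
      (Eventually.of_forall fun p => ?_))
    simp only [diffQuot, Pi.smul_apply, smul_eq_mul]
    ring

variable [MeasurableSpace X] [BorelSpace X] {γ : ℝ} {μ : Measure X}

theorem coeFn_diffQuotLin (h : AhlforsRegular γ μ) {s : ℝ} (hs : 0 < s)
    (u : sobolevSpace h (s / γ)) :
    diffQuotLin h hs u =ᵐ[μ.prod μ] diffQuot s γ (u : Lp ℝ 2 μ) :=
  MemLp.coeFn_toLp ((h.memLp_diffQuot_iff hs (u : Lp ℝ 2 μ)).2 u.2)

theorem dirichletIntegrand_ae_eq (h : AhlforsRegular γ μ) {s : ℝ} (hs : 0 < s)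
    (u v : sobolevSpace h (s / γ)) :
    dirichletIntegrand s γ (u : Lp ℝ 2 μ) (v : Lp ℝ 2 μ) =ᵐ[μ.prod μ]
      fun p => inner ℝ (diffQuotLin h hs u p) (diffQuotLin h hs v p) := by
  filter_upwards [coeFn_diffQuotLin h hs u, coeFn_diffQuotLin h hs v] with p h1 h2
  rw [dirichletIntegrand_eq_mul h.pos, h1, h2, real_inner_comm]
  rfl

theorem integrable_dirichletIntegrand (h : AhlforsRegular γ μ) {s : ℝ} (hs : 0 < s)
    (u v : sobolevSpace h (s / γ)) :
    Integrable (dirichletIntegrand s γ (u : Lp ℝ 2 μ) (v : Lp ℝ 2 μ)) (μ.prod μ) :=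
  (L2.integrable_inner (diffQuotLin h hs u) (diffQuotLin h hs v)).congr
    (dirichletIntegrand_ae_eq h hs u v).symm

theorem dirichletForm_eq_inner (h : AhlforsRegular γ μ) {s : ℝ} (hs : 0 < s)
    (u v : sobolevSpace h (s / γ)) :
    dirichletForm μ s γ (u : Lp ℝ 2 μ) (v : Lp ℝ 2 μ) =
      inner ℝ (diffQuotLin h hs u) (diffQuotLin h hs v) := by
  rw [L2.inner_def, dirichletForm, integral_congr_ae (dirichletIntegrand_ae_eq h hs u v)]

theorem norm_diffQuotLin_sq (h : AhlforsRegular γ μ) {s : ℝ} (hs : 0 < s)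
    (u : sobolevSpace h (s / γ)) :
    ‖diffQuotLin h hs u‖ ^ 2 = (distEnergy μ s γ (u : Lp ℝ 2 μ)).toReal := by
  have := h.secondCountableTopology
  have hm := measurable_diffQuot s γ (Lp.stronglyMeasurable (u : Lp ℝ 2 μ)).measurable
  rw [← real_inner_self_eq_norm_sq, ← dirichletForm_eq_inner, dirichletForm, distEnergy,
    ← integral_eq_lintegral_of_nonneg_ae (ae_of_all _ fun p => sq_nonneg _)
      (hm.pow_const 2).aestronglyMeasurable]
  exact integral_congr_ae (ae_of_all _ fun p => by
    simp only [dirichletIntegrand_eq_mul h.pos, sq])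

theorem sobolev_comparable (h : AhlforsRegular γ μ) {s : ℝ} (hs : 0 < s) :
    ∃ A : ℝ, 0 < A ∧ ∀ u : sobolevSpace h (s / γ),
      √(energy μ (s / γ) (u : Lp ℝ 2 μ)).toReal ≤ A * ‖diffQuotLin h hs u‖ ∧
      ‖diffQuotLin h hs u‖ ≤ A * √(energy μ (s / γ) (u : Lp ℝ 2 μ)).toReal := by
  have := h.secondCountableTopology
  obtain ⟨A, hA, H⟩ := h.energy_comparable hs
  refine ⟨√A, by positivity, fun u => ?_⟩
  obtain ⟨H1, H2⟩ := H (u : Lp ℝ 2 μ)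
  have hu : energy μ (s / γ) (u : Lp ℝ 2 μ) < ∞ := u.2
  have hu' : distEnergy μ s γ (u : Lp ℝ 2 μ) < ∞ :=
    H2.trans_lt (ENNReal.mul_lt_top ENNReal.ofReal_lt_top hu)
  have E := norm_diffQuotLin_sq h hs u
  constructor
  · rw [← Real.sqrt_sq (norm_nonneg (diffQuotLin h hs u)), ← Real.sqrt_mul hA.le, E]
    refine Real.sqrt_le_sqrt ((ENNReal.toReal_mono
      (ENNReal.mul_lt_top ENNReal.ofReal_lt_top hu').ne H1).trans_eq ?_)
    rw [ENNReal.toReal_mul, ENNReal.toReal_ofReal hA.le]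
  · rw [← Real.sqrt_sq (norm_nonneg (diffQuotLin h hs u)), ← Real.sqrt_mul hA.le, E]
    refine Real.sqrt_le_sqrt ((ENNReal.toReal_mono
      (ENNReal.mul_lt_top ENNReal.ofReal_lt_top hu).ne H2).trans_eq ?_)
    rw [ENNReal.toReal_mul, ENNReal.toReal_ofReal hA.le]

end Quotient

/-! ### Completeness, closedness and Riesz representation -/

section Hilbert

/-- Fréchet–Riesz for the form `⟪T u, T v⟫` when `T` is injective with complete range. -/
theorem existsUnique_inner_map_eq {V H : Type*} [AddCommGroup V] [Module ℝ V]
    [NormedAddCommGroup H] [InnerProductSpace ℝ H] (T : V →ₗ[ℝ] H) (hinj : Function.Injective T)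
    (hcomplete : IsComplete (LinearMap.range T : Set H)) (f : V →ₗ[ℝ] ℝ) {K : ℝ}
    (hf : ∀ v, |f v| ≤ K * ‖T v‖) : ∃! u : V, ∀ v : V, inner ℝ (T u) (T v) = f v := by
  have : CompleteSpace (LinearMap.range T) := hcomplete.completeSpace_coe
  let e := LinearEquiv.ofInjective T hinj
  -- `V` carries no topology here; `f` is transported to the range of `T`, where `hf` is precisely
  -- its continuity.
  let F : LinearMap.range T →L[ℝ] ℝ := (f.comp e.symm.toLinearMap).mkContinuous K fun y => by
    obtain ⟨v, rfl⟩ := e.surjective y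
    change |f (e.symm (e v))| ≤ K * ‖T v‖
    rw [e.symm_apply_apply]
    exact hf v
  obtain ⟨u, hu⟩ := e.surjective ((InnerProductSpace.toDual ℝ (LinearMap.range T)).symm F)
  have hrep : ∀ v : V, inner ℝ (T u) (T v) = f v := fun v => by
    have h1 := InnerProductSpace.toDual_symm_apply (x := e v) (y := F)
    rw [← hu] at h1
    have h2 : F (e v) = f v := by
      change f (e.symm (e v)) = f v
      rw [e.symm_apply_apply]
    exact h1.trans h2
  refine ⟨u, hrep, fun u' hu' => hinj ?_⟩
  refine sub_eq_zero.1 (inner_self_eq_zero (𝕜 := ℝ).1 ?_)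
  rw [← map_sub T, map_sub T, inner_sub_left, ← map_sub T, hu', hrep, sub_self]

variable {X : Type*} [MetricSpace X] [MeasurableSpace X] {γ : ℝ} {μ : Measure X}

theorem norm_le_sobolevNorm (σ : ℝ) (u : Lp ℝ 2 μ) : ‖u‖ ≤ sobolevNorm μ σ u :=
  le_add_of_nonneg_right (Real.sqrt_nonneg _)

theorem sqrt_energy_le_sobolevNorm (σ : ℝ) (u : Lp ℝ 2 μ) :
    √(energy μ σ u).toReal ≤ sobolevNorm μ σ u :=
  le_add_of_nonneg_left (norm_nonneg _)

variable [BorelSpace X]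

/-- The difference quotient is a closed operator. -/
theorem diffQuotLin_closed (h : AhlforsRegular γ μ) {s : ℝ} (hs : 0 < s)
    (w : ℕ → sobolevSpace h (s / γ)) (u : Lp ℝ 2 μ) (g : Lp ℝ 2 (μ.prod μ))
    (hu : Tendsto (fun n => (w n : Lp ℝ 2 μ)) atTop (𝓝 u))
    (hg : Tendsto (fun n => diffQuotLin h hs (w n)) atTop (𝓝 g)) :
    ∃ hmem : u ∈ sobolevSpace h (s / γ), diffQuotLin h hs ⟨u, hmem⟩ = g := by
  have := h.sigmaFinite
  have := h.secondCountableTopology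
  -- A subsequence converges almost everywhere on `X`, and a further one has its quotients
  -- converging almost everywhere on `X × X`. Pulling the first convergence back along both
  -- projections identifies the limit of the quotients pointwise.
  obtain ⟨a, ha, hau⟩ := (tendstoInMeasure_of_tendsto_Lp hu).exists_seq_tendsto_ae
  obtain ⟨b, hb, hbg⟩ := (tendstoInMeasure_of_tendsto_Lp
    (hg.comp ha.tendsto_atTop)).exists_seq_tendsto_ae
  have hae : diffQuot s γ u =ᵐ[μ.prod μ] g := by
    filter_upwards [(Measure.quasiMeasurePreserving_fst (μ := μ) (ν := μ)).ae hau,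
      (Measure.quasiMeasurePreserving_snd (μ := μ) (ν := μ)).ae hau, hbg,
      ae_all_iff.2 fun n => coeFn_diffQuotLin h hs (w (a (b n)))] with p h1 h2 h3 h4
    refine tendsto_nhds_unique ?_ h3
    have hb' := hb.tendsto_atTop
    refine Tendsto.congr (fun n => (h4 n).symm) ?_
    exact ((h1.comp hb').sub (h2.comp hb')).div_const _
  have hmem : u ∈ sobolevSpace h (s / γ) :=
    (h.memLp_diffQuot_iff hs u).1 ((memLp_congr_ae hae).2 (Lp.memLp g))
  exact ⟨hmem, Lp.ext ((coeFn_diffQuotLin h hs ⟨u, hmem⟩).trans hae)⟩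

/-- A Cauchy sequence for the Sobolev norm is Cauchy together with its difference quotients, so both
converge in `L²`. Closedness of the quotient matches the two limits, and continuity of `P` keeps the
limit in the kernel. -/
theorem sobolevSpace_inf_ker_complete (h : AhlforsRegular γ μ) {s : ℝ} (hs : 0 < s)
    (P : Lp ℝ 2 μ →L[ℝ] Lp ℝ 2 μ) (w : ℕ → Lp ℝ 2 μ)
    (hw : ∀ n, w n ∈ sobolevSpace h (s / γ) ⊓ P.ker)
    (hC : ∀ ε > 0, ∃ N, ∀ m ≥ N, ∀ n ≥ N, sobolevNorm μ (s / γ) (w m - w n) < ε) :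
    ∃ u ∈ sobolevSpace h (s / γ) ⊓ P.ker,
      Tendsto (fun n => sobolevNorm μ (s / γ) (w n - u)) atTop (𝓝 0) := by
  obtain ⟨A, hA, H⟩ := sobolev_comparable h hs
  let w' : ℕ → sobolevSpace h (s / γ) := fun n => ⟨w n, (hw n).1⟩
  have c1 : CauchySeq w := Metric.cauchySeq_iff.2 fun ε hε => by
    obtain ⟨N, hN⟩ := hC ε hε
    refine ⟨N, fun m hm n hn => ?_⟩
    rw [dist_eq_norm]
    exact (norm_le_sobolevNorm _ _).trans_lt (hN m hm n hn)
  have c2 : CauchySeq fun n => diffQuotLin h hs (w' n) := Metric.cauchySeq_iff.2 fun ε hε => by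
    obtain ⟨N, hN⟩ := hC (ε / A) (by positivity)
    refine ⟨N, fun m hm n hn => ?_⟩
    rw [dist_eq_norm, ← map_sub]
    refine (H (w' m - w' n)).2.trans_lt ?_
    rw [← lt_div_iff₀' hA]
    exact (sqrt_energy_le_sobolevNorm _ _).trans_lt (hN m hm n hn)
  obtain ⟨u, hu⟩ := cauchySeq_tendsto_of_complete c1
  obtain ⟨g, hg⟩ := cauchySeq_tendsto_of_complete c2
  obtain ⟨hmem, rfl⟩ := diffQuotLin_closed h hs w' u g hu hg
  refine ⟨u, ⟨hmem, ?_⟩, ?_⟩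
  · refine tendsto_nhds_unique ((P.continuous.tendsto u).comp hu) ?_
    refine tendsto_const_nhds.congr fun n => ?_
    exact (hw n).2.symm
  · have t1 := (tendsto_iff_norm_sub_tendsto_zero.1 hu).add
      ((tendsto_iff_norm_sub_tendsto_zero.1 hg).const_mul A)
    rw [mul_zero, add_zero] at t1
    refine squeeze_zero (fun n => (norm_nonneg _).trans (norm_le_sobolevNorm _ _)) (fun n => ?_) t1
    have h1 := (H (w' n - ⟨u, hmem⟩)).1
    rw [map_sub, Submodule.coe_sub] at h1
    exact add_le_add le_rfl h1

/-- Coercivity bounds the `L²` part of the norm by `c ^ (-1/2)` times the root of the energy, so the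
quotient alone controls the whole norm. -/
theorem IsCoercivitySpace.exists_sobolevNorm_le {h : AhlforsRegular γ μ} {s : ℝ} (hs : 0 < s)
    {V : Submodule ℝ (Lp ℝ 2 μ)} (hV : IsCoercivitySpace h (s / γ) V) :
    ∃ A : ℝ, 0 < A ∧ ∀ u : sobolevSpace h (s / γ), (u : Lp ℝ 2 μ) ∈ V →
      sobolevNorm μ (s / γ) u ≤ A * ‖diffQuotLin h hs u‖ := by
  obtain ⟨A, hA, H⟩ := sobolev_comparable h hs
  obtain ⟨c, hc, hcoer⟩ := hV.coercive
  refine ⟨((√c)⁻¹ + 1) * A, by positivity, fun u hu => ?_⟩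
  have h1 : √c * ‖(u : Lp ℝ 2 μ)‖ ≤ √(energy μ (s / γ) (u : Lp ℝ 2 μ)).toReal := by
    refine Real.le_sqrt_of_sq_le ?_
    rw [mul_pow, Real.sq_sqrt hc.le]
    exact (ENNReal.ofReal_le_iff_le_toReal (ne_of_lt u.2)).1 (hcoer u hu)
  have h1 : ‖(u : Lp ℝ 2 μ)‖ ≤ (√c)⁻¹ * √(energy μ (s / γ) (u : Lp ℝ 2 μ)).toReal := by
    rwa [le_inv_mul_iff₀ (by positivity)]
  calc sobolevNorm μ (s / γ) u ≤ ((√c)⁻¹ + 1) * √(energy μ (s / γ) (u : Lp ℝ 2 μ)).toReal := by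
        rw [add_mul, one_mul]
        exact add_le_add h1 le_rfl
    _ ≤ _ := by
        rw [mul_assoc]
        exact mul_le_mul_of_nonneg_left (H u).1 (by positivity)

/-- On a space of coercivity the Dirichlet form is the pull-back of an inner product, and the
corresponding norm is equivalent to the Sobolev norm. -/
theorem IsCoercivitySpace.exists_isometry {h : AhlforsRegular γ μ} {s : ℝ} (hs : 0 < s)
    {V : Submodule ℝ (Lp ℝ 2 μ)} (hV : IsCoercivitySpace h (s / γ) V) :
    ∃ T : V →ₗ[ℝ] Lp ℝ 2 (μ.prod μ), ∃ A B : ℝ, 0 < A ∧ 0 < B ∧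
      (∀ u v : V, dirichletForm μ s γ (u : Lp ℝ 2 μ) (v : Lp ℝ 2 μ) = inner ℝ (T u) (T v)) ∧
      (∀ v : V, ‖T v‖ ≤ A * sobolevNorm μ (s / γ) v) ∧
      ∀ v : V, sobolevNorm μ (s / γ) v ≤ B * ‖T v‖ := by
  obtain ⟨A, hA, H⟩ := sobolev_comparable h hs
  obtain ⟨B, hB, HB⟩ := hV.exists_sobolevNorm_le hs
  refine ⟨(diffQuotLin h hs).comp (Submodule.inclusion hV.le_sobolevSpace), A, B, hA, hB,
    fun u v => ?_, fun v => ?_, fun v => ?_⟩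
  · exact dirichletForm_eq_inner h hs (Submodule.inclusion hV.le_sobolevSpace u)
      (Submodule.inclusion hV.le_sobolevSpace v)
  · exact (H (Submodule.inclusion hV.le_sobolevSpace v)).2.trans
      (mul_le_mul_of_nonneg_left (sqrt_energy_le_sobolevNorm _ _) hA.le)
  · exact HB (Submodule.inclusion hV.le_sobolevSpace v) v.2

/-- Bounded functionals on a space of coercivity are represented by the Dirichlet form. -/
theorem IsCoercivitySpace.existsUnique_dirichletForm_eq {h : AhlforsRegular γ μ} {s : ℝ}
    (hs : 0 < s) {V : Submodule ℝ (Lp ℝ 2 μ)} (hV : IsCoercivitySpace h (s / γ) V)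
    (f : V →ₗ[ℝ] ℝ) (hf : ∃ K : ℝ, ∀ v : V, |f v| ≤ K * sobolevNorm μ (s / γ) v) :
    ∃! u : V, ∀ v : V, dirichletForm μ s γ (u : Lp ℝ 2 μ) (v : Lp ℝ 2 μ) = f v := by
  obtain ⟨T, A, B, hA, hB, hform, hT', hT⟩ := hV.exists_isometry hs
  obtain ⟨K, hK⟩ := hf
  have hinj : Function.Injective T := by
    refine (injective_iff_map_eq_zero T).2 fun v hv => ?_
    have := (norm_le_sobolevNorm (s / γ) (v : Lp ℝ 2 μ)).trans (hT v)
    rw [hv, norm_zero, mul_zero] at this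
    exact Subtype.ext (norm_le_zero_iff.1 this)
  -- If `T (w n)` converges, the lower bound on `T` makes `w n` Cauchy for the Sobolev norm.
  -- Completeness of `V` gives a limit `u`, and the upper bound gives `T (w n) → T u`.
  have hcomplete : IsComplete (LinearMap.range T : Set (Lp ℝ 2 (μ.prod μ))) := by
    refine IsClosed.isComplete (IsSeqClosed.isClosed fun x g hx hg => ?_)
    choose w hw using hx
    have hC := Metric.cauchySeq_iff.1 hg.cauchySeq
    obtain ⟨u, hu, hlim⟩ := hV.complete (fun n => w n) (fun n => (w n).2) fun ε hε => by
      obtain ⟨N, hN⟩ := hC (ε / B) (by positivity)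
      refine ⟨N, fun m hm n hn => ?_⟩
      rw [← Submodule.coe_sub]
      refine (hT (w m - w n)).trans_lt ?_
      rw [← lt_div_iff₀' hB, map_sub, hw, hw, ← dist_eq_norm]
      exact hN m hm n hn
    refine ⟨⟨u, hu⟩, tendsto_nhds_unique (tendsto_iff_norm_sub_tendsto_zero.2 ?_) hg⟩
    have := hlim.const_mul A
    rw [mul_zero] at this
    refine squeeze_zero (fun n => norm_nonneg _) (fun n => ?_) this
    have h1 := hT' (w n - ⟨u, hu⟩)
    rwa [map_sub, hw, Submodule.coe_sub] at h1
  -- `max K 0` is used because nothing forces `K` to be nonnegative.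
  refine (existsUnique_congr fun u => forall_congr' fun v => ?_).1
    (existsUnique_inner_map_eq T hinj hcomplete f (K := max K 0 * B) fun v => ?_)
  · rw [hform]
  · rw [mul_assoc]
    exact (hK v).trans (mul_le_mul (le_max_left _ _) (hT v)
      ((norm_nonneg _).trans (norm_le_sobolevNorm _ _)) (le_max_right _ _))

end Hilbert

/-! ### The Poincaré inequality on one set -/

section Poincare

variable {X : Type*} [MeasurableSpace X] {μ : Measure X}

theorem ofReal_norm_sq_eq_lintegral (u : Lp ℝ 2 μ) :
    ENNReal.ofReal (‖u‖ ^ 2) = ∫⁻ x, ENNReal.ofReal (u x ^ 2) ∂μ := by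
  rw [← real_inner_self_eq_norm_sq, L2.inner_def,
    ← ofReal_integral_eq_lintegral_ofReal (Lp.memLp u).integrable_sq
      (ae_of_all _ fun x => sq_nonneg _)]
  congr 2
  funext x
  simp only [real_inner_self_eq_norm_sq, Real.norm_eq_abs, sq_abs]

/-- For fixed `x`, expand the square and integrate over `y ∈ Q`: the cross term vanishes by `h0`,
leaving `μ(Q) u(x)² + ∫_Q u²`, whose second term is dropped. -/
theorem measure_mul_setLIntegral_sq_le [SFinite μ] {u : X → ℝ} (hu : Measurable u)
    (hu2 : MemLp u 2 μ) {Q : Set X} (hQ : μ Q ≠ ∞) (h0 : ∫ x in Q, u x ∂μ = 0) :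
    μ Q * ∫⁻ x in Q, ENNReal.ofReal (u x ^ 2) ∂μ ≤
      ∫⁻ p in Q ×ˢ Q, ENNReal.ofReal ((u p.1 - u p.2) ^ 2) ∂(μ.prod μ) := by
  have : IsFiniteMeasure (μ.restrict Q) := ⟨by simpa using hQ.lt_top⟩
  have hi2 : Integrable (fun y => u y ^ 2) (μ.restrict Q) := hu2.integrable_sq.restrict
  have hi1 : Integrable u (μ.restrict Q) := (hu2.restrict Q).integrable one_le_two
  have hm : Measurable fun p : X × X => ENNReal.ofReal ((u p.1 - u p.2) ^ 2) := by fun_prop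
  rw [← Measure.prod_restrict, lintegral_prod _ hm.aemeasurable,
    ← lintegral_const_mul' _ _ hQ]
  refine lintegral_mono fun x => ?_
  have hix : Integrable (fun y => u x ^ 2 - 2 * u x * u y) (μ.restrict Q) :=
    (integrable_const _).sub (hi1.const_mul _)
  have e : ∀ y, (u x - u y) ^ 2 = (u x ^ 2 - 2 * u x * u y) + u y ^ 2 := fun y => by ring
  have hint : Integrable (fun y => (u x - u y) ^ 2) (μ.restrict Q) := by
    simp only [e]
    exact hix.add hi2
  rw [← ofReal_integral_eq_lintegral_ofReal hint (ae_of_all _ fun y => sq_nonneg _)]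
  have hval : ∫ y in Q, (u x - u y) ^ 2 ∂μ = μ.real Q * u x ^ 2 + ∫ y in Q, u y ^ 2 ∂μ := by
    simp only [e]
    rw [integral_add hix hi2, integral_sub (integrable_const _) (hi1.const_mul _),
      integral_const_mul, h0]
    simp
  have hnn : 0 ≤ ∫ y in Q, u y ^ 2 ∂μ := integral_nonneg fun y => sq_nonneg _
  rw [hval, ← ENNReal.ofReal_toReal hQ, ← ENNReal.ofReal_mul ENNReal.toReal_nonneg]
  exact ENNReal.ofReal_le_ofReal (le_add_of_nonneg_right hnn)

/-- On `Q × Q` the distance is at most `d`, so `d ^ (γ + 2 s)` absorbs the denominator of the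
squared quotient. -/
theorem setLIntegral_sub_sq_le_diffQuot {X : Type*} [MetricSpace X] [MeasurableSpace X]
    {μ : Measure X} {γ s d : ℝ} (hγ : 0 < γ) (hs : 0 < s) (u : X → ℝ) {Q : Set X}
    (hQm : MeasurableSet Q) (hQ : ∀ x ∈ Q, ∀ y ∈ Q, dist x y ≤ d) :
    ∫⁻ p in Q ×ˢ Q, ENNReal.ofReal ((u p.1 - u p.2) ^ 2) ∂(μ.prod μ) ≤
      ENNReal.ofReal (d ^ (γ + 2 * s)) *
        ∫⁻ p in Q ×ˢ Q, ENNReal.ofReal (diffQuot s γ u p ^ 2) ∂(μ.prod μ) := by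
  rw [← lintegral_const_mul' _ _ ENNReal.ofReal_ne_top]
  refine setLIntegral_mono' (hQm.prod hQm) fun p hp => ?_
  have hd0 : 0 ≤ d := dist_nonneg.trans (hQ _ hp.1 _ hp.2)
  rw [← ENNReal.ofReal_mul (by positivity), diffQuot_sq hγ hs, sq_abs]
  refine ENNReal.ofReal_le_ofReal ?_
  rcases eq_or_ne p.1 p.2 with e | e
  · simp [e]
  have hd := dist_pos.2 e
  rw [← mul_div_assoc, le_div_iff₀ (by positivity), mul_comm]
  exact mul_le_mul_of_nonneg_right (Real.rpow_le_rpow hd.le (hQ _ hp.1 _ hp.2) (by positivity))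
    (sq_nonneg _)

end Poincare

/-! ### Size of dyadic cubes and coercivity from vanishing means -/

section Cubes

variable {X : Type*} [MetricSpace X] [MeasurableSpace X] {γ : ℝ} {μ : Measure X}
  {D : ℤ → Set (Set X)}

/-- The cubes of a dyadic family are bounded and as large as balls of comparable diameter. -/
theorem IsDyadicFamily.exists_size (hD : IsDyadicFamily D) (h : AhlforsRegular γ μ) :
    ∃ ν b C : ℝ, 0 < ν ∧ ν < 1 ∧ 0 < b ∧ 0 < C ∧ ∀ j : ℤ, ∀ Q ∈ D j,
      ENNReal.ofReal (b * (ν ^ j) ^ γ) ≤ μ Q ∧ ∀ x ∈ Q, ∀ y ∈ Q, dist x y ≤ C * ν ^ j := by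
  have hγ := h.pos
  obtain ⟨ν, hν0, hν1, c, C, hc, hC, H⟩ := hD.size
  obtain ⟨c₁, c₂, h₁, -, Hμ⟩ := h.regular
  refine ⟨ν, c₁ * (c ^ 2 / 4) ^ γ, C, hν0, hν1, by positivity, hC, fun j Q hQ => ⟨?_, ?_⟩⟩
  · obtain ⟨⟨hd, -⟩, he, -⟩ := H j Q hQ
    -- The supremum need not be attained; halving `c` yields actual balls with `r₁ / r₂ > c / 2`.
    have he' : ENNReal.ofReal (c / 2) < eccentricity Q :=
      ((ENNReal.ofReal_lt_ofReal_iff hc).2 (by linarith)).trans_le he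
    simp only [eccentricity, lt_iSup_iff] at he'
    obtain ⟨x₁, r₁, x₂, r₂, hr₁, hr₂, hsub₁, hsub₂, hlt⟩ := he'
    rw [ENNReal.ofReal_lt_ofReal_iff (by positivity), lt_div_iff₀ hr₂] at hlt
    have hdiam : Metric.ediam Q ≤ ENNReal.ofReal (2 * r₂) := by
      refine Metric.ediam_le fun x hx y hy => ?_
      rw [edist_dist]
      refine ENNReal.ofReal_le_ofReal ?_
      have h1 := Metric.mem_ball.1 (hsub₂ hx)
      have h2 := Metric.mem_ball.1 (hsub₂ hy)
      linarith [dist_triangle_right x y x₂]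
    have hle := (ENNReal.ofReal_le_ofReal_iff (by positivity)).1 (hd.trans hdiam)
    -- Combine `c ν ^ j ≤ diam Q ≤ 2 r₂` with `r₂ < 2 r₁ / c`.
    have hr : c ^ 2 / 4 * ν ^ j ≤ r₁ := by nlinarith
    refine le_trans (ENNReal.ofReal_le_ofReal ?_) ((Hμ x₁ r₁ hr₁).1.trans (measure_mono hsub₁))
    rw [mul_assoc, ← Real.mul_rpow (by positivity) (by positivity)]
    gcongr
  · intro x hx y hy
    have := (Metric.edist_le_ediam_of_mem hx hy).trans (H j Q hQ).1.2
    rw [edist_dist] at this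
    exact (ENNReal.ofReal_le_ofReal_iff (by positivity)).1 this

theorem IsDyadicFamily.measure_lt_top (hD : IsDyadicFamily D) (h : AhlforsRegular γ μ) {j : ℤ}
    {Q : Set X} (hQ : Q ∈ D j) : μ Q < ∞ := by
  obtain ⟨ν, b, C, -, -, -, -, H⟩ := hD.exists_size h
  exact h.measure_lt_top (Metric.isBounded_iff.2 ⟨_, fun x hx y hy => (H j Q hQ).2 x hx y hy⟩)

theorem IsDyadicFamily.measure_pos (hD : IsDyadicFamily D) (h : AhlforsRegular γ μ) {j : ℤ}
    {Q : Set X} (hQ : Q ∈ D j) : 0 < μ Q := by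
  obtain ⟨ν, b, C, hν, -, hb, -, H⟩ := hD.exists_size h
  exact (ENNReal.ofReal_pos.2 (by positivity)).trans_le (H j Q hQ).1

/-- The lower bound `b (ν ^ (i - n)) ^ γ` is uniform over the level and tends to infinity with `n`,
because `ν < 1`. -/
theorem IsDyadicFamily.exists_level_le_measure (hD : IsDyadicFamily D) (h : AhlforsRegular γ μ)
    (i : ℤ) (M : ℝ) : ∃ n : ℕ, ∀ Q ∈ D (i - n), M ≤ μ.real Q := by
  obtain ⟨ν, b, C, hν, hν1, hb, -, H⟩ := hD.exists_size h
  have ht : Tendsto (fun n : ℕ => b * (ν ^ i * ν⁻¹ ^ n) ^ γ) atTop atTop :=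
    ((tendsto_rpow_atTop h.pos).comp ((tendsto_pow_atTop_atTop_of_one_lt
      ((one_lt_inv₀ hν).2 hν1)).const_mul_atTop (zpow_pos hν i))).const_mul_atTop hb
  obtain ⟨n, hn⟩ := (ht.eventually_ge_atTop M).exists
  refine ⟨n, fun Q hQ => hn.trans ?_⟩
  have h1 := (H _ Q hQ).1
  rw [zpow_sub₀ hν.ne', zpow_natCast, div_eq_mul_inv, ← inv_pow] at h1
  exact (ENNReal.ofReal_le_iff_le_toReal (hD.measure_lt_top h hQ).ne).1 h1

theorem IsDyadicFamily.subset_or_disjoint (hD : IsDyadicFamily D) {j : ℤ} {Q R : Set X}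
    (hQ : Q ∈ D j) (hR : R ∈ D j) : Q ⊆ R ∨ Disjoint Q R := by
  rcases eq_or_ne Q R with rfl | hne
  · exact Or.inl subset_rfl
  · exact Or.inr ((hD.partition j).pairwiseDisjoint hQ hR hne)

theorem IsDyadicFamily.countable [BorelSpace X] (hD : IsDyadicFamily D) (h : AhlforsRegular γ μ)
    (j : ℤ) : (D j).Countable := by
  have := h.sigmaFinite
  refine Set.countable_coe_iff.1 ?_
  have := Measure.countable_meas_pos_of_disjoint_iUnion (μ := μ)
    (As := fun Q : D j => (Q : Set X)) (fun Q => hD.measurableSet j Q Q.2)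
    (fun Q R hQR => (hD.partition j).pairwiseDisjoint Q.2 R.2 fun e => hQR (Subtype.ext e))
  exact Set.countable_univ_iff.1 (this.mono fun Q _ => hD.measure_pos h Q.2)

/-- The Poincaré inequality, summed over the cubes of one level. -/
theorem IsDyadicFamily.exists_coercive [BorelSpace X] (hD : IsDyadicFamily D)
    (h : AhlforsRegular γ μ) {s : ℝ} (hs : 0 < s) (j : ℤ) :
    ∃ c : ℝ, 0 < c ∧ ∀ u : Lp ℝ 2 μ, (∀ Q ∈ D j, ∫ x in Q, u x ∂μ = 0) →
      ENNReal.ofReal (c * ‖u‖ ^ 2) ≤ energy μ (s / γ) u := by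
  have := h.sigmaFinite
  have hγ := h.pos
  obtain ⟨ν, b, C, hν, -, hb, hC, H⟩ := hD.exists_size h
  obtain ⟨A, hA, HA⟩ := h.energy_comparable hs
  set m : ℝ := b * (ν ^ j) ^ γ
  set d : ℝ := (C * ν ^ j) ^ (γ + 2 * s)
  have hm : 0 < m := by positivity
  have hd : 0 < d := by positivity
  -- Here `m` bounds the measures of the cubes from below, `d` is the diameter bound to the power `γ
  -- + 2 s`, and `A` compares the two energies.
  refine ⟨m / (d * A), by positivity, fun u hu => ?_⟩
  have : Countable (D j) := (hD.countable h j).to_subtype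
  have hdisj : Pairwise (Function.onFun Disjoint fun Q : D j => (Q : Set X)) := fun Q R hQR =>
    (hD.partition j).pairwiseDisjoint Q.2 R.2 fun e => hQR (Subtype.ext e)
  have hcover : ⋃ Q : D j, (Q : Set X) = univ := by
    rw [← sUnion_eq_iUnion, (hD.partition j).sUnion_eq_univ]
  have hmain : ENNReal.ofReal m * ENNReal.ofReal (‖u‖ ^ 2) ≤
      ENNReal.ofReal d * distEnergy μ s γ u := by
    calc ENNReal.ofReal m * ENNReal.ofReal (‖u‖ ^ 2)
        = ∑' Q : D j, ENNReal.ofReal m * ∫⁻ x in (Q : Set X), ENNReal.ofReal (u x ^ 2) ∂μ := by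
          rw [ENNReal.tsum_mul_left, ofReal_norm_sq_eq_lintegral,
            ← lintegral_iUnion (fun Q : D j => hD.measurableSet j Q Q.2) hdisj, hcover,
            Measure.restrict_univ]
      _ ≤ ∑' Q : D j, ENNReal.ofReal d * ∫⁻ p in (Q : Set X) ×ˢ (Q : Set X),
            ENNReal.ofReal (diffQuot s γ u p ^ 2) ∂(μ.prod μ) :=
          ENNReal.tsum_le_tsum fun Q => (mul_le_mul_left (H j Q Q.2).1 _).trans
            ((measure_mul_setLIntegral_sq_le (Lp.stronglyMeasurable u).measurable (Lp.memLp u)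
              (hD.measure_lt_top h Q.2).ne (hu Q Q.2)).trans
            (setLIntegral_sub_sq_le_diffQuot hγ hs u (hD.measurableSet j Q Q.2) (H j Q Q.2).2))
      -- The squares `Q × Q` are pairwise disjoint, so their contributions add up to at most the
      -- full integral.
      _ ≤ ENNReal.ofReal d * distEnergy μ s γ u := by
          rw [ENNReal.tsum_mul_left, ← lintegral_iUnion
            (fun Q : D j => (hD.measurableSet j Q Q.2).prod (hD.measurableSet j Q Q.2))
            fun Q R hQR => Set.disjoint_prod.2 (Or.inl (hdisj hQR))]
          exact mul_le_mul_right (setLIntegral_le_lintegral _ _) _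
  have h2 : ENNReal.ofReal (m * ‖u‖ ^ 2) ≤ ENNReal.ofReal (d * A) * energy μ (s / γ) u := by
    rw [ENNReal.ofReal_mul hm.le, ENNReal.ofReal_mul hd.le, mul_assoc]
    exact hmain.trans (mul_le_mul_right (HA u).2 _)
  rw [div_mul_eq_mul_div, ENNReal.ofReal_div_of_pos (by positivity)]
  exact ENNReal.div_le_of_le_mul' h2

end Cubes

/-! ### Vanishing means on the kernels of the projectors -/

section Projections

variable {X : Type*} [MeasurableSpace X] {μ : Measure X}

theorem indicatorConstLp_mem_stepSpace {𝒬 : Set (Set X)} {Q S : Set X} (hQ : MeasurableSet Q)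
    (hμQ : μ Q ≠ ∞) (hQS : Q ⊆ S) (h𝒬 : ∀ R ∈ 𝒬, R ⊆ Q ∨ Disjoint R Q) :
    indicatorConstLp 2 hQ hμQ (1 : ℝ) ∈ stepSpace μ 𝒬 S := by
  refine ⟨fun R hR => ?_, ?_⟩
  · rcases h𝒬 R hR with hRQ | hRQ
    · refine ⟨1, ?_⟩
      filter_upwards [indicatorConstLp_coeFn (p := 2) (hs := hQ) (hμs := hμQ) (c := (1 : ℝ))]
        with x hx hxR
      rw [hx, indicator_of_mem (hRQ hxR)]
    · refine ⟨0, ?_⟩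
      filter_upwards [indicatorConstLp_coeFn (p := 2) (hs := hQ) (hμs := hμQ) (c := (1 : ℝ))]
        with x hx hxR
      rw [hx, indicator_of_notMem (hRQ.notMem_of_mem_left hxR)]
  · filter_upwards [indicatorConstLp_coeFn (p := 2) (hs := hQ) (hμs := hμQ) (c := (1 : ℝ))]
      with x hx hxS
    rw [hx, indicator_of_notMem fun hxQ => hxS (hQS hxQ)]

theorem normIndicator_eq_smul {Q : Set X} (hQ : MeasurableSet Q) (hμQ : μ Q ≠ ∞) :
    normIndicator μ Q = (1 / √(μ.real Q)) • indicatorConstLp 2 hQ hμQ (1 : ℝ) := by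
  have hmem : MemLp (Q.indicator fun _ => (1 / √(μ.real Q) : ℝ)) 2 μ :=
    memLp_indicator_const 2 hQ _ (Or.inr hμQ)
  rw [normIndicator, dif_pos hmem]
  refine Lp.ext (hmem.coeFn_toLp.trans ?_)
  filter_upwards [indicatorConstLp_coeFn (p := 2) (hs := hQ) (hμs := hμQ) (c := (1 : ℝ)),
    Lp.coeFn_smul (1 / √(μ.real Q)) (indicatorConstLp 2 hQ hμQ (1 : ℝ))] with x h1 h2
  rw [h2, Pi.smul_apply, h1]
  by_cases hx : x ∈ Q <;> simp [hx]

/-- Cauchy–Schwarz against the indicator of `Q`. -/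
theorem setIntegral_sq_mul_le (u : Lp ℝ 2 μ) {Q : Set X} (hQ : MeasurableSet Q)
    (hμQ : μ Q ≠ ∞) : (∫ x in Q, u x ∂μ) ^ 2 ≤ μ.real Q * ‖u‖ ^ 2 := by
  have h1 := abs_real_inner_le_norm (indicatorConstLp 2 hQ hμQ (1 : ℝ)) u
  rw [L2.inner_indicatorConstLp_one, norm_indicatorConstLp (by simp) (by simp), norm_one,
    one_mul] at h1
  have h2 := pow_le_pow_left₀ (abs_nonneg _) h1 2
  rw [sq_abs, mul_pow, ← Real.rpow_mul_natCast measureReal_nonneg] at h2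
  simpa using h2

theorem IsHaarSystem.inner_eq_zero_of_haarProj {D : ℤ → Set (Set X)} {𝓗 : ℤ → Set X → Set (Lp ℝ 2 μ)} {t : ℝ}
    {u : Lp ℝ 2 μ} (hu : haarProj μ D 𝓗 t u = 0) {j : ℤ} {Q : Set X} (hQ : Q ∈ D j)
    (ht : ENNReal.ofReal t < μ Q) : ∀ g ∈ 𝓗 j Q, inner ℝ g u = 0 := by
  intro g hg
  rw [haarProj, Submodule.starProjection_apply_eq_zero_iff] at hu
  exact hu _ (Submodule.le_topologicalClosure _ (Submodule.subset_span ⟨j, Q, hQ, ht, hg⟩))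

/-- A function orthogonal to the Haar functions of `Q` has the same mean on `Q` as on each of its
offspring. -/
theorem IsHaarSystem.measureReal_mul_setIntegral_eq [MetricSpace X] {γ : ℝ}
    {D : ℤ → Set (Set X)} {𝓗 : ℤ → Set X → Set (Lp ℝ 2 μ)} (h𝓗 : IsHaarSystem μ D 𝓗)
    (hD : IsDyadicFamily D) (h : AhlforsRegular γ μ) {j : ℤ} {Q Q' : Set X} (hQ : Q ∈ D j)
    (hQ' : Q' ∈ offspring D j Q) {u : Lp ℝ 2 μ} (hu : ∀ g ∈ 𝓗 j Q, inner ℝ g u = 0) :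
    μ.real Q * ∫ x in Q', u x ∂μ = μ.real Q' * ∫ x in Q, u x ∂μ := by
  have hm := hD.measurableSet j Q hQ
  have hm' := hD.measurableSet _ Q' hQ'.1
  have hf := (hD.measure_lt_top h hQ).ne
  have hf' := (hD.measure_lt_top h hQ'.1).ne
  -- The product of `g` with `u` is the difference of the two sides of the claim. Since `g` is a
  -- step function orthogonal to the indicator of `Q`, its coefficient `a` on that indicator
  -- vanishes and it lies in the span of the Haar functions.
  set g : Lp ℝ 2 μ := μ.real Q • indicatorConstLp 2 hm' hf' (1 : ℝ) -
    μ.real Q' • indicatorConstLp 2 hm hf (1 : ℝ) with hg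
  have hmem : g ∈ stepSpace μ (offspring D j Q) Q := by
    refine Submodule.sub_mem _ (Submodule.smul_mem _ _ ?_) (Submodule.smul_mem _ _ ?_)
    · exact indicatorConstLp_mem_stepSpace _ _ hQ'.2 fun R hR => hD.subset_or_disjoint hR.1 hQ'.1
    · exact indicatorConstLp_mem_stepSpace _ _ subset_rfl fun R hR => Or.inl hR.2
  rw [← h𝓗.span_eq j Q hQ, Submodule.mem_span_insert] at hmem
  obtain ⟨a, z, hz, hgz⟩ := hmem
  have hon := h𝓗.orthonormal j Q hQ
  have hnz : inner ℝ (normIndicator μ Q) z = 0 := by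
    refine Submodule.span_induction (p := fun z _ => inner ℝ (normIndicator μ Q) z = 0)
      (fun y hy => ?_) (inner_zero_right _) (fun x y _ _ hx hy => ?_) (fun c x _ hx => ?_) hz
    · refine hon.2 (i := ⟨_, mem_insert _ _⟩) (j := ⟨y, mem_insert_of_mem _ hy⟩) fun e => ?_
      have e' : normIndicator μ Q = y := congrArg Subtype.val e
      -- Orthonormality is that of a set, so `notMem` is needed to know that the indicator differs
      -- from every Haar function.
      exact h𝓗.notMem j Q hQ (e' ▸ hy)
    · rw [inner_add_right, hx, hy, add_zero]
    · rw [inner_smul_right, hx, mul_zero]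
  have huz : inner ℝ z u = 0 := by
    refine Submodule.span_induction (p := fun z _ => inner ℝ z u = 0)
      (fun y hy => hu y hy) (inner_zero_left _) (fun x y _ _ hx hy => ?_) (fun c x _ hx => ?_) hz
    · rw [inner_add_left, hx, hy, add_zero]
    · rw [real_inner_smul_left, hx, mul_zero]
  have hnn : inner ℝ (normIndicator μ Q) (normIndicator μ Q) = (1 : ℝ) := by
    rw [real_inner_self_eq_norm_sq, hon.1 ⟨_, mem_insert _ _⟩, one_pow]
  have hng : inner ℝ (normIndicator μ Q) g = 0 := by
    rw [normIndicator_eq_smul hm hf, real_inner_smul_left, hg, inner_sub_right, inner_smul_right,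
      inner_smul_right, L2.inner_indicatorConstLp_indicatorConstLp,
      L2.inner_indicatorConstLp_indicatorConstLp, inter_self, inter_eq_right.2 hQ'.2]
    simp [mul_comm]
  have ha : a = 0 := by
    rw [hgz, inner_add_right, inner_smul_right, hnn, hnz] at hng
    simpa using hng
  rw [ha, zero_smul, zero_add] at hgz
  rw [← hgz, hg, inner_sub_left, real_inner_smul_left, real_inner_smul_left,
    L2.inner_indicatorConstLp_one, L2.inner_indicatorConstLp_one, sub_eq_zero] at huz
  exact huz

variable [MetricSpace X] {γ : ℝ} {D : ℤ → Set (Set X)}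

/-- The indicator of a cube of level `j` is itself in `V_j`, the other cubes of the level being
disjoint from it. -/
theorem IsDyadicFamily.setIntegral_eq_zero_of_levelProj (hD : IsDyadicFamily D)
    (h : AhlforsRegular γ μ) {j : ℤ} {u : Lp ℝ 2 μ} (hu : levelProj μ D j u = 0) {Q : Set X}
    (hQ : Q ∈ D j) : ∫ x in Q, u x ∂μ = 0 := by
  rw [levelProj, Submodule.starProjection_apply_eq_zero_iff] at hu
  rw [← L2.inner_indicatorConstLp_one (𝕜 := ℝ) (hD.measurableSet j Q hQ)
    (hD.measure_lt_top h hQ).ne]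
  exact hu _ (Submodule.le_topologicalClosure _ (indicatorConstLp_mem_stepSpace _ _
    (subset_univ _) fun R hR => hD.subset_or_disjoint hR hQ))

/-- Equality of means passes from child to parent. Every ancestor contains `Q`, so its measure also
exceeds `t` and its Haar functions are orthogonal to `u`. -/
theorem IsHaarSystem.exists_ancestor {𝓗 : ℤ → Set X → Set (Lp ℝ 2 μ)}
    (h𝓗 : IsHaarSystem μ D 𝓗) (hD : IsDyadicFamily D) (h : AhlforsRegular γ μ) {t : ℝ}
    {u : Lp ℝ 2 μ} (hu : haarProj μ D 𝓗 t u = 0) {j : ℤ} {Q : Set X} (hQ : Q ∈ D j)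
    (ht : ENNReal.ofReal t < μ Q) (n : ℕ) :
    ∃ R ∈ D (j - n), Q ⊆ R ∧ μ.real R * ∫ x in Q, u x ∂μ = μ.real Q * ∫ x in R, u x ∂μ := by
  induction n with
  | zero => exact ⟨Q, by simpa using hQ, subset_rfl, rfl⟩
  | succ n ih =>
    obtain ⟨R, hR, hQR, e⟩ := ih
    have hR' : R ∈ D (j - (n + 1 : ℕ) + 1) := by
      convert hR using 2
      push_cast
      ring
    obtain ⟨S, ⟨hS, hRS⟩, -⟩ := hD.parent _ R hR'
    refine ⟨S, hS, hQR.trans hRS, ?_⟩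
    have e' := h𝓗.measureReal_mul_setIntegral_eq hD h hS ⟨hR', hRS⟩
      (inner_eq_zero_of_haarProj hu hS (ht.trans_le (measure_mono (hQR.trans hRS))))
    have hpos : μ.real R ≠ 0 :=
      (ENNReal.toReal_pos (hD.measure_pos h hR).ne' (hD.measure_lt_top h hR).ne).ne'
    refine mul_left_cancel₀ hpos ?_
    linear_combination μ.real S * e + μ.real Q * e'

/-- Equal means on `Q` and an ancestor `R`, with Cauchy–Schwarz on `R`, give `μ(R) I² ≤ μ(Q)² ‖u‖²`.
Since `μ(R)` can be taken arbitrarily large, `I = 0`. -/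
theorem IsHaarSystem.setIntegral_eq_zero_of_haarProj {𝓗 : ℤ → Set X → Set (Lp ℝ 2 μ)}
    (h𝓗 : IsHaarSystem μ D 𝓗) (hD : IsDyadicFamily D) (h : AhlforsRegular γ μ) {t : ℝ}
    {u : Lp ℝ 2 μ} (hu : haarProj μ D 𝓗 t u = 0) {j : ℤ} {Q : Set X} (hQ : Q ∈ D j)
    (ht : ENNReal.ofReal t < μ Q) : ∫ x in Q, u x ∂μ = 0 := by
  set I := ∫ x in Q, u x ∂μ
  by_contra hI
  have hI2 : 0 < I ^ 2 := by positivity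
  obtain ⟨n, hn⟩ := hD.exists_level_le_measure h j
    (((μ.real Q) ^ 2 * ‖u‖ ^ 2 + 1) / I ^ 2)
  obtain ⟨R, hR, -, e⟩ := h𝓗.exists_ancestor hD h hu hQ ht n
  have hpos : 0 < μ.real R :=
    ENNReal.toReal_pos (hD.measure_pos h hR).ne' (hD.measure_lt_top h hR).ne
  have h1 := setIntegral_sq_mul_le u (hD.measurableSet _ R hR) (hD.measure_lt_top h hR).ne
  have h2 := hn R hR
  rw [div_le_iff₀ hI2] at h2
  have h3 : μ.real R * (μ.real R * I ^ 2) ≤ μ.real R * ((μ.real Q) ^ 2 * ‖u‖ ^ 2) := by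
    calc μ.real R * (μ.real R * I ^ 2) = (μ.real R * I) ^ 2 := by ring
      _ = (μ.real Q) ^ 2 * (∫ x in R, u x ∂μ) ^ 2 := by rw [e]; ring
      _ ≤ (μ.real Q) ^ 2 * (μ.real R * ‖u‖ ^ 2) := by gcongr
      _ = _ := by ring
  linarith [le_of_mul_le_mul_left h3 hpos]

end Projections

end HomType
end

theorem theorem5p1 {X : Type*} [MetricSpace X] [MeasurableSpace X] [BorelSpace X]
    (μ : Measure X) (γ s : ℝ) (hs : 0 < s) (hμ : HomType.AhlforsRegular γ μ) :
    (∀ D : ℤ → Set (Set X), HomType.IsDyadicFamily D →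
      (∀ 𝓗 : ℤ → Set X → Set (Lp ℝ 2 μ), HomType.IsHaarSystem μ D 𝓗 → ∀ t : ℝ, 0 < t →
        HomType.IsCoercivitySpace hμ (s / γ)
          (HomType.sobolevSpace hμ (s / γ) ⊓ (HomType.haarProj μ D 𝓗 t).ker)) ∧
      (∀ j : ℤ, HomType.IsCoercivitySpace hμ (s / γ)
          (HomType.sobolevSpace hμ (s / γ) ⊓ (HomType.levelProj μ D j).ker))) ∧
    ∀ V : Submodule ℝ (Lp ℝ 2 μ), HomType.IsCoercivitySpace hμ (s / γ) V →
      (∃ C : ℝ, ∀ u ∈ V, ∀ v ∈ V,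
        Integrable (HomType.dirichletIntegrand s γ u v) (μ.prod μ) ∧
        |HomType.dirichletForm μ s γ u v| ≤
          C * HomType.sobolevNorm μ (s / γ) u * HomType.sobolevNorm μ (s / γ) v) ∧
      (∃ c : ℝ, 0 < c ∧ ∀ u ∈ V,
        c * HomType.sobolevNorm μ (s / γ) u ^ 2 ≤ HomType.dirichletForm μ s γ u u) ∧
      ∀ f : V →ₗ[ℝ] ℝ,
        (∃ K : ℝ, ∀ v : V, |f v| ≤ K * HomType.sobolevNorm μ (s / γ) v) →
        ∃! u : V, ∀ v : V,
          HomType.dirichletForm μ s γ (u : Lp ℝ 2 μ) (v : Lp ℝ 2 μ) = f v := by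
  refine ⟨fun D hD => ⟨fun 𝓗 h𝓗 t ht => ⟨inf_le_left,
    HomType.sobolevSpace_inf_ker_complete hμ hs _, ?_⟩, fun j => ⟨inf_le_left,
    HomType.sobolevSpace_inf_ker_complete hμ hs _, ?_⟩⟩, fun V hV => ⟨?_, ?_, fun f hf =>
    hV.existsUnique_dirichletForm_eq hs f hf⟩⟩
  -- Choose a level so coarse that all its cubes have measure above `t`; the means of `u` vanish on
  -- every one of them.
  · obtain ⟨n, hn⟩ := hD.exists_level_le_measure hμ 0 (t + 1)
    obtain ⟨c, hc, H⟩ := hD.exists_coercive hμ hs (0 - n)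
    refine ⟨c, hc, fun u hu => H u fun Q hQ =>
      h𝓗.setIntegral_eq_zero_of_haarProj hD hμ hu.2 hQ ?_⟩
    rw [ENNReal.ofReal_lt_iff_lt_toReal ht.le (hD.measure_lt_top hμ hQ).ne]
    exact (lt_add_one t).trans_le (hn Q hQ)
  · obtain ⟨c, hc, H⟩ := hD.exists_coercive hμ hs j
    exact ⟨c, hc, fun u hu => H u fun Q hQ => hD.setIntegral_eq_zero_of_levelProj hμ hu.2 hQ⟩
  · obtain ⟨T, A, B, hA, hB, hform, hT, -⟩ := hV.exists_isometry hs
    refine ⟨A * A, fun u hu v hv => ⟨HomType.integrable_dirichletIntegrand hμ hs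
      ⟨u, hV.le_sobolevSpace hu⟩ ⟨v, hV.le_sobolevSpace hv⟩, ?_⟩⟩
    rw [hform ⟨u, hu⟩ ⟨v, hv⟩]
    refine (abs_real_inner_le_norm _ _).trans ?_
    calc ‖T ⟨u, hu⟩‖ * ‖T ⟨v, hv⟩‖
        ≤ (A * HomType.sobolevNorm μ (s / γ) u) * (A * HomType.sobolevNorm μ (s / γ) v) :=
          mul_le_mul (hT ⟨u, hu⟩) (hT ⟨v, hv⟩) (norm_nonneg _) (mul_nonneg hA.le
            ((norm_nonneg _).trans (HomType.norm_le_sobolevNorm _ _)))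
      _ = _ := by ring
  · obtain ⟨T, A, B, hA, hB, hform, -, hT⟩ := hV.exists_isometry hs
    refine ⟨(B ^ 2)⁻¹, by positivity, fun u hu => ?_⟩
    rw [hform ⟨u, hu⟩ ⟨u, hu⟩, real_inner_self_eq_norm_sq, inv_mul_le_iff₀ (by positivity),
      ← mul_pow]
    exact pow_le_pow_left₀ ((norm_nonneg _).trans (HomType.norm_le_sobolevNorm _ _))
      (hT ⟨u, hu⟩) 2
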